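/- **Setting.** A Clifford circuit $\mathcal C=(C_1,\dots,C_s)$ on $n$ qubits is a finite sequence of operations in chronological order, each of which is either a Clifford unitary gate (a unitary that maps $n$-qubit Pauli operators to $n$-qubit Pauli operators by conjugation) or the measurement of a Hermitian $n$-qubit Pauli operator. Each operation has a level in $\{1,2,\dots\}$; levels are non-decreasing along the sequence, and distinct operations of the same level have disjoint supports. Let $S_1,\dots,S_m$ be the measured operators, in order. The outcome $o_j\in\mathbb Z_2$ of the measurement of $S_j$ corresponds to the eigenvalue $(-1)^{o_j}$, that is, to the projector $\frac12\left(I+(-1)^{o_j}S_j\right)$. The *outcome code* $\mathcal O(\mathcal C)\subseteq\mathbb Z_2^m$ is the set of all bit-strings $o=(o_1,\dots,o_m)$ that occur with non-zero probability for at least one input state (density matrix) of the $n$ qubits. **Stabilizer simulation.** Start with $\mathcal S=\emptyset$ and process $C_1,\dots,C_s$ in order; $\langle\mathcal S\rangle$ denotes the group generated by $\mathcal S$. - If $C_i$ is a unitary gate, replace every $T\in\mathcal S$ by $C_iTC_i^{-1}$. - If $C_i$ is the measurement of $S_j$ and $S_j\in\langle\mathcal S\rangle$ or $-S_j\in\langle\mathcal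 S\rangle$, leave $\mathcal S$ unchanged. - If $C_i$ is the measurement of $S_j$ and neither $S_j$ nor $-S_j$ is in $\langle\mathcal S\rangle$: if some element of $\mathcal S$ anti-commutes with $S_j$, choose such an element $T$, replace every other $T'\in\mathcal S$ that anti-commutes with $S_j$ by $TT'$, and remove $T$ from $\mathcal S$. Then, in any case, add $S_j$ to $\mathcal S$. **Corollary (Linearization of the outcome code).** Let $\mathcal C$ be a Clifford circuit with $m$ measurements, and let $\mathcal C'$ be the circuit obtained from $\mathcal C$ by running this simulation, with any choices of the elements $T$, and replacing the measured operator $S_j$ by $-S_j$ whenever $-S_j\in\langle\mathcal S\rangle$ at the time when $S_j$ is measured. Then the outcome code $\mathcal O(\mathcal C')$ is a linear code, that is, a $\mathbb Z_2$-linear subspace of $\mathbb Z_2^m$. -/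

import Mathlib

namespace CliffordSim

/-- Linear operators on `n` qubits, as matrices in the computational basis `{0,1}ⁿ`. -/
abbrev QubitOp (n : ℕ) : Type := Matrix (Fin n → Fin 2) (Fin n → Fin 2) ℂ

/-- The group of unitary operators on `n` qubits. -/
abbrev QubitUnitary (n : ℕ) : Type := Matrix.unitaryGroup (Fin n → Fin 2) ℂ

/-- The four single-qubit Pauli matrices `I, X, Y, Z`. -/
noncomputable def pauliMatrix : Fin 4 → Matrix (Fin 2) (Fin 2) ℂ :=
  ![!![1, 0; 0, 1], !![0, 1; 1, 0], !![0, -Complex.I; Complex.I, 0], !![1, 0; 0, -1]]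

/-- The tensor product `σ_{p 0} ⊗ ⋯ ⊗ σ_{p (n-1)}` of single-qubit Pauli matrices. -/
noncomputable def pauliString {n : ℕ} (p : Fin n → Fin 4) : QubitOp n :=
  Matrix.of fun x y => ∏ q, pauliMatrix (p q) (x q) (y q)

/-- `P` is an `n`-qubit Pauli operator: a tensor product of `I, X, Y, Z` times a phase
`1, i, -1, -i`. -/
def IsPauli {n : ℕ} (P : QubitUnitary n) : Prop :=
  ∃ (k : Fin 4) (p : Fin n → Fin 4), (P : QubitOp n) = Complex.I ^ (k : ℕ) • pauliString p

/-- A Clifford unitary: it conjugates Pauli operators to Pauli operators. -/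
def IsClifford {n : ℕ} (U : QubitUnitary n) : Prop :=
  ∀ P : QubitUnitary n, IsPauli P → IsPauli (U * P * U⁻¹)

/-- A Pauli observable: a Hermitian Pauli operator, so that its measurement has the
possible results `±1`. -/
def IsPauliObservable {n : ℕ} (S : QubitUnitary n) : Prop :=
  IsPauli S ∧ (S : QubitOp n).IsHermitian

theorem IsPauliObservable.neg {n : ℕ} {S : QubitUnitary n} (h : IsPauliObservable S) :
    IsPauliObservable (-S) := by
  obtain ⟨⟨k, p, hk⟩, hS⟩ := h
  refine ⟨⟨k + 2, p, ?_⟩, by rw [Unitary.coe_neg]; exact hS.neg⟩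
  rw [Unitary.coe_neg, hk, ← neg_smul]
  congr 1
  fin_cases k <;> simp [pow_succ]

/-- `M` acts as the identity on qubit `q`: it is `I_q ⊗ M'` for an operator `M'` on the
other qubits. -/
def ActsTriviallyOn {n : ℕ} (M : QubitOp n) (q : Fin n) : Prop :=
  (∀ x y : Fin n → Fin 2, x q ≠ y q → M x y = 0) ∧
    ∀ (x y : Fin n → Fin 2) (a : Fin 2), x q = y q →
      M (Function.update x q a) (Function.update y q a) = M x y

/-- The set of qubits on which an operator acts non-trivially. -/
def support {n : ℕ} (M : QubitOp n) : Set (Fin n) := {q | ¬ ActsTriviallyOn M q}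

theorem support_neg {n : ℕ} (M : QubitOp n) : support (-M) = support M := by
  simp [support, ActsTriviallyOn]

/-- A Clifford operation: a Clifford unitary gate or the measurement of a Pauli observable. -/
inductive Operation (n : ℕ) : Type
  | gate (U : QubitUnitary n) (hU : IsClifford U) : Operation n
  | measure (S : QubitUnitary n) (hS : IsPauliObservable S) : Operation n

namespace Operation

variable {n : ℕ}

def IsMeasurement : Operation n → Prop
  | gate _ _ => False
  | measure _ _ => True

def support : Operation n → Set (Fin n)
  | gate U _ => CliffordSim.support (U : QubitOp n)
  | measure S _ => CliffordSim.support (S : QubitOp n)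

/-- The operator applied to the state: the unitary itself for a gate, and the projector
`(I + (-1)^b S) / 2` for the measurement of `S` with outcome `b` (for a gate `b` is ignored). -/
noncomputable def kraus : Operation n → ZMod 2 → QubitOp n
  | gate U _, _ => U
  | measure S _, b => (2⁻¹ : ℂ) • (1 + (-1 : ℂ) ^ b.val • (S : QubitOp n))

end Operation

end CliffordSim

/-- A Clifford circuit on `n` qubits: a chronologically ordered sequence of Clifford
operations, each applied at a time step called its level, such that distinct operations of the
same level have disjoint supports. -/
structure CliffordCircuit (n : ℕ) where
  size : ℕ
  op : Fin size → CliffordSim.Operation n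
  level : Fin size → ℕ
  one_le_level : ∀ i, 1 ≤ level i
  level_mono : Monotone level
  disjoint_support : ∀ i j, i ≠ j → level i = level j → Disjoint (op i).support (op j).support

namespace CliffordCircuit

open CliffordSim

variable {n : ℕ}

/-- The positions of the measurements of the circuit; outcome bit-strings are indexed by this
set, which has one element for each of the `m` measurements, in chronological order. -/
abbrev Meas (C : CliffordCircuit n) : Type := {i : Fin C.size // (C.op i).IsMeasurement}

/-- The outcome bit at position `i` (and `0` if operation `i` is a gate, which does not use it). -/
noncomputable def bit (C : CliffordCircuit n) (o : C.Meas → ZMod 2) (i : Fin C.size) : ZMod 2 :=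
  open Classical in if h : (C.op i).IsMeasurement then o ⟨i, h⟩ else 0

/-- The unnormalized state, on input `ρ`, after the first `i` operations with measurement
outcomes `o`. Its trace is the probability of the outcomes of these operations. -/
noncomputable def stateAfter (C : CliffordCircuit n) (ρ : QubitOp n) (o : C.Meas → ZMod 2) :
    ℕ → QubitOp n
  | 0 => ρ
  | i + 1 =>
    if h : i < C.size then
      (C.op ⟨i, h⟩).kraus (C.bit o ⟨i, h⟩) * C.stateAfter ρ o i *
        ((C.op ⟨i, h⟩).kraus (C.bit o ⟨i, h⟩)).conjTranspose
    else C.stateAfter ρ o i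

open scoped ComplexOrder in
/-- Density matrices of `n` qubits. -/
def IsDensityMatrix (ρ : QubitOp n) : Prop := ρ.PosSemidef ∧ ρ.trace = 1

/-- The probability that the circuit with input state `ρ` yields the outcome bit-string `o`. -/
noncomputable def outcomeProb (C : CliffordCircuit n) (ρ : QubitOp n) (o : C.Meas → ZMod 2) : ℝ :=
  (C.stateAfter ρ o C.size).trace.re

/-- The outcome code: the set of all outcome bit-strings that occur with non-zero probability
for some input state. -/
def outcomeCode (C : CliffordCircuit n) : Set (C.Meas → ZMod 2) :=
  {o | ∃ ρ : QubitOp n, IsDensityMatrix ρ ∧ 0 < C.outcomeProb ρ o}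

/-- A rule for the choice left open in the stabilizer simulation: at step `i`, given the current
set `𝒮` of generators and a measured operator `S` that anti-commutes with some element of `𝒮`,
it selects such an element. Every sequence of choices is given by such a rule. -/
structure PivotRule (n : ℕ) where
  pick : ℕ → Set (QubitUnitary n) → QubitUnitary n → QubitUnitary n
  pick_spec : ∀ (i : ℕ) (𝒮 : Set (QubitUnitary n)) (S : QubitUnitary n),
    (∃ T ∈ 𝒮, T * S = -(S * T)) →
      pick i 𝒮 S ∈ 𝒮 ∧ pick i 𝒮 S * S = -(S * pick i 𝒮 S)

theorem PivotRule.nonempty (n : ℕ) : Nonempty (PivotRule n) := by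
  classical
  exact ⟨⟨fun _ 𝒮 S => if h : ∃ T ∈ 𝒮, T * S = -(S * T) then h.choose else 1,
    fun _ 𝒮 S h => by simpa only [dif_pos h] using h.choose_spec⟩⟩

/-- The update of the set `𝒮` of stabilizer generators by the `i`-th operation. A gate conjugates
every generator. The measurement of `S` changes nothing if `±S` is in the group generated
by `𝒮`. Otherwise, if some element of `𝒮` anti-commutes with `S`, one such element `T` is selected
and removed, every other `T'` that anti-commutes with `S` is replaced by `T T'`, and `S` is added;
if no element anti-commutes with `S`, then `S` is added.
(The simulation also records a list of parity checks; it has no influence on `𝒮`.) -/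
noncomputable def updateGenerators (rule : PivotRule n) (i : ℕ) (𝒮 : Set (QubitUnitary n)) :
    Operation n → Set (QubitUnitary n)
  | .gate U _ => (fun T => U * T * U⁻¹) '' 𝒮
  | .measure S _ =>
    open Classical in
    if S ∈ Subgroup.closure 𝒮 ∨ -S ∈ Subgroup.closure 𝒮 then 𝒮
    else if ∃ T ∈ 𝒮, T * S = -(S * T) then
      insert S ((fun T' => if T' * S = -(S * T') then rule.pick i 𝒮 S * T' else T') ''
        (𝒮 \ {rule.pick i 𝒮 S}))
    else insert S 𝒮

/-- The set of stabilizer generators held by the simulation after the first `i` operations. -/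
noncomputable def generators (C : CliffordCircuit n) (rule : PivotRule n) :
    ℕ → Set (QubitUnitary n)
  | 0 => ∅
  | i + 1 =>
    if h : i < C.size then updateGenerators rule i (C.generators rule i) (C.op ⟨i, h⟩)
    else C.generators rule i

/-- The measurement of `S` is replaced by that of `-S` if `-S` is in the group generated by `𝒮`;
all other operations are kept. -/
noncomputable def flipSign (𝒮 : Set (QubitUnitary n)) : Operation n → Operation n
  | .gate U hU => .gate U hU
  | .measure S hS =>
    open Classical in
    if -S ∈ Subgroup.closure 𝒮 then .measure (-S) hS.neg else .measure S hS

theorem support_flipSign (𝒮 : Set (QubitUnitary n)) (c : Operation n) :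
    (flipSign 𝒮 c).support = c.support := by
  cases c with
  | gate U hU => rfl
  | measure S hS =>
    simp only [flipSign]
    split_ifs
    · simp only [Operation.support, Unitary.coe_neg, support_neg]
    · rfl

/-- The circuit obtained from `C` by running the stabilizer simulation and replacing the measured
operator `S` by `-S` whenever `-S` is in the current stabilizer group. -/
noncomputable def linearize (C : CliffordCircuit n) (rule : PivotRule n) : CliffordCircuit n where
  size := C.size
  op i := flipSign (C.generators rule i) (C.op i)
  level := C.level
  one_le_level := C.one_le_level
  level_mono := C.level_mono
  disjoint_support i j hij hl := by
    simpa only [support_flipSign] using C.disjoint_support i j hij hl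

end CliffordCircuit

/-! For an outcome string `o`, let `K o` be the product of the gates and outcome projectors applied
so far. Then `o` is realizable exactly when `K o ≠ 0`, as the maximally mixed input shows; on that
input the state is proportional to `K o * (K o)ᴴ`.

The proof is an induction along the circuit on `StabilizerInvariant`. Its clause `mem` says that an
observable outside the stabilizer group, up to sign, has expectation zero. Measuring it therefore
gives either outcome with conditional probability 1/2 and imposes no condition on `o`
(`measure_of_notMem`). Its clause `sign` says that a group element acts on `K o` as `(-1) ^ m(o)`
with `m` linear. Measuring it therefore imposes one homogeneous equation, outcome bit = `m(o)`
(`measure_of_mem`). Had `-S` been in the group and `S` been measured, the equation would be the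
affine one, bit = `m(o) + 1`; the sign change removes this constant. The realizable strings are thus
cut out of the whole space by homogeneous equations. -/

namespace CliffordSim

open Matrix

/-! ### Pauli operators -/

section Pauli

theorem pauliMatrix_mul (a b : Fin 4) :
    ∃ (k : ℕ) (c : Fin 4), pauliMatrix a * pauliMatrix b = Complex.I ^ k • pauliMatrix c := by
  have h3 : Complex.I ^ 3 = -Complex.I := by rw [pow_succ, Complex.I_sq]; ring
  -- The multiplication table of `I, X, Y, Z`: first the exponents of the phase, then the indices of
  -- the product.
  refine ⟨![![0, 0, 0, 0], ![0, 0, 1, 3], ![0, 3, 0, 1], ![0, 1, 3, 0]] a b,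
    ![![0, 1, 2, 3], ![1, 0, 3, 2], ![2, 3, 0, 1], ![3, 2, 1, 0]] a b, ?_⟩
  fin_cases a <;> fin_cases b <;> ext i j <;> fin_cases i <;> fin_cases j <;>
    simp [pauliMatrix, h3]

theorem pauliMatrix_mul_comm (a b : Fin 4) :
    ∃ s : ℤˣ, pauliMatrix a * pauliMatrix b = ((s : ℤ) : ℂ) • (pauliMatrix b * pauliMatrix a) := by
  -- Distinct non-identity Pauli matrices anticommute; all other pairs commute.
  refine ⟨if a = 0 ∨ b = 0 ∨ a = b then 1 else -1, ?_⟩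
  fin_cases a <;> fin_cases b <;> ext i j <;> fin_cases i <;> fin_cases j <;> simp [pauliMatrix]

theorem trace_pauliMatrix {a : Fin 4} (ha : a ≠ 0) : (pauliMatrix a).trace = 0 := by
  fin_cases a <;> simp_all [pauliMatrix, Matrix.trace_fin_two]

variable {n : ℕ}

theorem tensor_mul (A B : Fin n → Matrix (Fin 2) (Fin 2) ℂ) :
    (Matrix.of fun x y => ∏ q, A q (x q) (y q) : QubitOp n) *
      (Matrix.of fun x y => ∏ q, B q (x q) (y q)) =
      Matrix.of fun x y => ∏ q, (A q * B q) (x q) (y q) := by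
  ext x y
  simp only [Matrix.mul_apply, Matrix.of_apply, ← Finset.prod_mul_distrib]
  rw [Finset.prod_univ_sum, Fintype.piFinset_univ]

theorem tensor_smul (c : Fin n → ℂ) (A : Fin n → Matrix (Fin 2) (Fin 2) ℂ) :
    (Matrix.of fun x y => ∏ q, (c q • A q) (x q) (y q) : QubitOp n) =
      (∏ q, c q) • Matrix.of fun x y => ∏ q, A q (x q) (y q) := by
  ext x y
  simp [Finset.prod_mul_distrib]

theorem pauliString_mul (p q : Fin n → Fin 4) :
    ∃ (k : ℕ) (r : Fin n → Fin 4),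
      pauliString p * pauliString q = Complex.I ^ k • pauliString r := by
  choose k c h using pauliMatrix_mul
  refine ⟨∑ i, k (p i) (q i), fun i => c (p i) (q i), ?_⟩
  simp only [pauliString]
  rw [tensor_mul]
  simp only [h]
  rw [tensor_smul, Finset.prod_pow_eq_pow_sum]

theorem pauliString_mul_comm (p q : Fin n → Fin 4) :
    ∃ s : ℤˣ, pauliString p * pauliString q =
      ((s : ℤ) : ℂ) • (pauliString q * pauliString p) := by
  choose s h using pauliMatrix_mul_comm
  refine ⟨∏ i, s (p i) (q i), ?_⟩
  simp only [pauliString]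
  rw [tensor_mul, tensor_mul]
  simp only [h (p _) (q _)]
  rw [tensor_smul]
  push_cast
  rfl

theorem pauliString_zero : pauliString (0 : Fin n → Fin 4) = 1 := by
  have h : pauliMatrix 0 = 1 := by
    ext i j; fin_cases i <;> fin_cases j <;> simp [pauliMatrix]
  ext x y
  simp only [pauliString, Matrix.of_apply, Pi.zero_apply, h, Matrix.one_apply]
  rw [Finset.prod_ite_zero]
  simp [funext_iff]

theorem trace_pauliString {p : Fin n → Fin 4} (hp : p ≠ 0) : (pauliString p).trace = 0 := by
  obtain ⟨i, hi⟩ := Function.ne_iff.mp hp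
  have h : (pauliString p).trace = ∏ q, (pauliMatrix (p q)).trace := by
    simp only [Matrix.trace, Matrix.diag_apply, pauliString, Matrix.of_apply]
    rw [Finset.prod_univ_sum, Fintype.piFinset_univ]
  rw [h]
  exact Finset.prod_eq_zero (Finset.mem_univ i) (trace_pauliMatrix hi)

theorem IsPauli.mul {P Q : QubitUnitary n} (hP : IsPauli P) (hQ : IsPauli Q) :
    IsPauli (P * Q) := by
  obtain ⟨k, p, hp⟩ := hP
  obtain ⟨l, q, hq⟩ := hQ
  obtain ⟨m, r, h⟩ := pauliString_mul p q
  refine ⟨⟨(k + l + m) % 4, Nat.mod_lt _ (by norm_num)⟩, r, ?_⟩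
  rw [Submonoid.coe_mul, hp, hq, smul_mul_smul_comm, h, smul_smul, ← pow_add, ← pow_add]
  congr 1
  exact pow_eq_pow_mod _ Complex.I_pow_four

theorem IsPauli.commute_or_anticommute {P Q : QubitUnitary n} (hP : IsPauli P)
    (hQ : IsPauli Q) : P * Q = Q * P ∨ P * Q = -(Q * P) := by
  obtain ⟨k, p, hp⟩ := hP
  obtain ⟨l, q, hq⟩ := hQ
  obtain ⟨s, h⟩ := pauliString_mul_comm p q
  rcases Int.units_eq_one_or s with rfl | rfl
  · left
    apply Subtype.ext
    rw [Submonoid.coe_mul, Submonoid.coe_mul, hp, hq, smul_mul_smul_comm, smul_mul_smul_comm, h]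
    simp [mul_comm]
  · right
    apply Subtype.ext
    rw [Unitary.coe_neg, Submonoid.coe_mul, Submonoid.coe_mul, hp, hq, smul_mul_smul_comm,
      smul_mul_smul_comm, h]
    simp [mul_comm]

theorem finite_isPauli : {P : QubitUnitary n | IsPauli P}.Finite := by
  refine Set.Finite.of_finite_image (f := fun P : QubitUnitary n => (P : QubitOp n)) ?_
    Subtype.val_injective.injOn
  refine (Set.finite_range fun kp : Fin 4 × (Fin n → Fin 4) =>
    Complex.I ^ (kp.1 : ℕ) • pauliString kp.2).subset ?_
  rintro _ ⟨P, ⟨k, p, h⟩, rfl⟩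
  exact ⟨(k, p), h.symm⟩

/-- Conjugation by `U` is an injective self-map of the finite set of Pauli operators, hence
surjective. -/
theorem IsClifford.isPauli_conj_inv {U : QubitUnitary n} (hU : IsClifford U)
    {P : QubitUnitary n} (hP : IsPauli P) : IsPauli (U⁻¹ * P * U) := by
  have hinj : Function.Injective fun Q : QubitUnitary n => U * Q * U⁻¹ :=
    (MulAut.conj U).injective
  obtain ⟨Q, hQ, rfl⟩ := (finite_isPauli.injOn_iff_bijOn_of_mapsTo hU).mp hinj.injOn |>.surjOn hP
  simpa [mul_assoc] using hQ

/-- A Pauli observable squares to the identity. -/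
theorem IsPauliObservable.mul_self {S : QubitUnitary n} (hS : IsPauliObservable S) :
    S * S = 1 := by
  apply Subtype.ext
  have h := Unitary.coe_mul_star_self S
  rw [Unitary.coe_star, Matrix.star_eq_conjTranspose, hS.2.eq] at h
  exact h

/-- Non-identity Pauli strings are traceless, and squaring to the identity leaves only the phases
`±1`. This is the base case of the clause `mem`, where the stabilizer group is trivial. -/
theorem IsPauliObservable.eq_one_or_neg_one {P : QubitUnitary n} (hP : IsPauliObservable P)
    (h : (P : QubitOp n).trace ≠ 0) : P = 1 ∨ P = -1 := by
  obtain ⟨k, p, hp⟩ := hP.1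
  have hp0 : p = 0 := by
    by_contra hne
    rw [hp, Matrix.trace_smul, trace_pauliString hne, smul_zero] at h
    exact h rfl
  rw [hp0, pauliString_zero] at hp
  have hsq := congrArg (Subtype.val) hP.mul_self
  rw [Submonoid.coe_mul, hp, smul_mul_smul_comm, one_mul, OneMemClass.coe_one] at hsq
  have hk := congrFun (congrFun hsq 0) 0
  simp only [Matrix.smul_apply, Matrix.one_apply_eq, smul_eq_mul, mul_one] at hk
  rcases mul_self_eq_one_iff.mp hk with hk | hk
  · left; apply Subtype.ext; rw [hp, hk]; simp
  · right; apply Subtype.ext; rw [hp, hk]; simp [Unitary.coe_neg]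

theorem IsPauliObservable.mul {P Q : QubitUnitary n} (hP : IsPauliObservable P)
    (hQ : IsPauliObservable Q) (h : P * Q = Q * P) : IsPauliObservable (P * Q) := by
  refine ⟨hP.1.mul hQ.1, ?_⟩
  rw [Submonoid.coe_mul, Matrix.IsHermitian, Matrix.conjTranspose_mul, hP.2.eq, hQ.2.eq,
    ← Submonoid.coe_mul, ← h, Submonoid.coe_mul]

theorem coe_inv_eq_conjTranspose (U : QubitUnitary n) :
    ((U⁻¹ : QubitUnitary n) : QubitOp n) = (U : QubitOp n)ᴴ := rfl

theorem IsPauliObservable.conj {P U : QubitUnitary n} (hP : IsPauliObservable P)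
    (hU : IsPauli (U * P * U⁻¹)) : IsPauliObservable (U * P * U⁻¹) := by
  refine ⟨hU, ?_⟩
  rw [Submonoid.coe_mul, Submonoid.coe_mul, coe_inv_eq_conjTranspose]
  exact Matrix.isHermitian_mul_mul_conjTranspose _ hP.2

theorem ne_neg_self (P : QubitUnitary n) : P ≠ -P := by
  intro h
  have h1 : (1 : QubitUnitary n) = -1 := by
    have := congrArg (fun X => X * P⁻¹) h
    simpa using this
  have h2 := congrFun (congrFun (congrArg (fun X : QubitUnitary n => (X : QubitOp n)) h1) 0) 0
  simp only [Unitary.coe_neg, OneMemClass.coe_one, Matrix.neg_apply, Matrix.one_apply_eq] at h2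
  norm_num at h2

end Pauli

end CliffordSim

namespace CliffordSim

open Matrix

/-! ### Signs, outcome projectors and the stabilizer invariant. -/

section Stabilizer

/-- The sign `(-1)^b`. -/
noncomputable def bitSign (b : ZMod 2) : ℂ := (-1 : ℂ) ^ b.val

theorem bitSign_zero : bitSign 0 = 1 := by simp [bitSign]

theorem bitSign_one : bitSign 1 = -1 := by simp [bitSign, ZMod.val_one]

theorem zmod_two_eq_zero_or_one (b : ZMod 2) : b = 0 ∨ b = 1 := by
  fin_cases b
  · exact Or.inl rfl
  · exact Or.inr rfl

theorem bitSign_add (a b : ZMod 2) : bitSign (a + b) = bitSign a * bitSign b := by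
  have h : (1 : ZMod 2) + 1 = 0 := rfl
  rcases zmod_two_eq_zero_or_one a with rfl | rfl <;>
    rcases zmod_two_eq_zero_or_one b with rfl | rfl <;>
    simp [bitSign_zero, bitSign_one, h]

theorem bitSign_mul_self (a : ZMod 2) : bitSign a * bitSign a = 1 := by
  rw [← bitSign_add, CharTwo.add_self_eq_zero, bitSign_zero]

variable {n : ℕ}

/-- The projector onto the eigenspace of `S` for the measurement outcome `b`. -/
noncomputable def outcomeProjector (S : QubitUnitary n) (b : ZMod 2) : QubitOp n :=
  (2⁻¹ : ℂ) • (1 + bitSign b • (S : QubitOp n))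

theorem IsPauliObservable.coe_mul_self {S : QubitUnitary n} (hS : IsPauliObservable S) :
    (S : QubitOp n) * S = 1 :=
  congrArg Subtype.val hS.mul_self

theorem conjTranspose_outcomeProjector {S : QubitUnitary n} (hS : IsPauliObservable S)
    (b : ZMod 2) : (outcomeProjector S b)ᴴ = outcomeProjector S b := by
  have h : star (bitSign b) = bitSign b := by simp [bitSign]
  have h2 : star (2⁻¹ : ℂ) = 2⁻¹ := by simp
  rw [outcomeProjector, conjTranspose_smul, conjTranspose_add, conjTranspose_smul, hS.2.eq, h,
    conjTranspose_one, h2]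

theorem mul_outcomeProjector_self {S : QubitUnitary n} (hS : IsPauliObservable S)
    (b : ZMod 2) : (S : QubitOp n) * outcomeProjector S b = bitSign b • outcomeProjector S b := by
  rw [outcomeProjector, Matrix.mul_smul, mul_add, mul_one, Matrix.mul_smul, hS.coe_mul_self,
    smul_comm (bitSign b), smul_add (bitSign b), smul_smul (bitSign b), bitSign_mul_self, one_smul,
    add_comm]

theorem outcomeProjector_mul_self {S : QubitUnitary n} (hS : IsPauliObservable S)
    (b : ZMod 2) : outcomeProjector S b * outcomeProjector S b = outcomeProjector S b := by
  conv_lhs => enter [1]; rw [outcomeProjector]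
  rw [Matrix.smul_mul, add_mul, one_mul, Matrix.smul_mul, mul_outcomeProjector_self hS, smul_smul,
    bitSign_mul_self, one_smul, ← two_smul ℂ, smul_smul, inv_mul_cancel₀ two_ne_zero, one_smul]

theorem mul_outcomeProjector_of_commute {S P : QubitUnitary n} (h : P * S = S * P)
    (b : ZMod 2) : (P : QubitOp n) * outcomeProjector S b = outcomeProjector S b * P := by
  have h' : (P : QubitOp n) * S = S * P := congrArg Subtype.val h
  simp only [outcomeProjector, Matrix.mul_smul, Matrix.smul_mul, mul_add, add_mul, mul_one,
    one_mul, h']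

/-- An operator that anticommutes with `S` swaps its two eigenspaces, so its diagonal blocks vanish.
-/
theorem outcomeProjector_mul_mul_of_anticommute {S P : QubitUnitary n}
    (hS : IsPauliObservable S) (h : P * S = -(S * P)) (b : ZMod 2) :
    outcomeProjector S b * P * outcomeProjector S b = 0 := by
  have h' : (P : QubitOp n) * S = -(S * P) := by
    simpa only [Unitary.coe_neg, Submonoid.coe_mul] using congrArg Subtype.val h
  have hP : (P : QubitOp n) * outcomeProjector S b =
      (2⁻¹ : ℂ) • ((1 - bitSign b • (S : QubitOp n)) * P) := by
    rw [outcomeProjector, Matrix.mul_smul, mul_add, mul_one, Matrix.mul_smul, h', sub_mul,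
      one_mul, Matrix.smul_mul, smul_neg, sub_eq_add_neg]
  have h0 : outcomeProjector S b * (1 - bitSign b • (S : QubitOp n)) = 0 := by
    rw [mul_sub, mul_one, Matrix.mul_smul, ← mul_outcomeProjector_of_commute rfl,
      mul_outcomeProjector_self hS, smul_smul, bitSign_mul_self, one_smul, sub_self]
  rw [mul_assoc, hP, Matrix.mul_smul, ← mul_assoc, h0, zero_mul, smul_zero]

theorem trace_mul_outcomeProjector_mul (S P : QubitUnitary n) (b : ZMod 2) (M : QubitOp n) :
    ((P : QubitOp n) * outcomeProjector S b * M).trace =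
      2⁻¹ * (((P : QubitOp n) * M).trace +
        bitSign b * (((P * S : QubitUnitary n) : QubitOp n) * M).trace) := by
  rw [outcomeProjector, Matrix.mul_smul, mul_add, mul_one, Matrix.mul_smul, Matrix.smul_mul,
    add_mul, Matrix.smul_mul, trace_smul, trace_add, trace_smul, smul_eq_mul, smul_eq_mul,
    Submonoid.coe_mul]

theorem trace_mul_outcomeProjector_sandwich {S : QubitUnitary n} (hS : IsPauliObservable S)
    (P : QubitUnitary n) (b : ZMod 2) (K : QubitOp n) :
    ((P : QubitOp n) * (outcomeProjector S b * K * (outcomeProjector S b * K)ᴴ)).trace =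
      (outcomeProjector S b * P * outcomeProjector S b * (K * Kᴴ)).trace := by
  rw [conjTranspose_mul, conjTranspose_outcomeProjector hS, ← mul_assoc, ← mul_assoc,
    trace_mul_comm]
  simp only [mul_assoc]

/-- Cyclicity of the trace and idempotence of the projector reduce the expectation after the
measurement to those of `P` and `P * S` before it. The case `P = 1` gives the outcome probability.
-/
theorem trace_mul_outcomeProjector_sandwich_of_commute {S : QubitUnitary n}
    (hS : IsPauliObservable S) {P : QubitUnitary n} (h : P * S = S * P) (b : ZMod 2)
    (K : QubitOp n) :
    ((P : QubitOp n) * (outcomeProjector S b * K * (outcomeProjector S b * K)ᴴ)).trace =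
      2⁻¹ * (((P : QubitOp n) * (K * Kᴴ)).trace +
        bitSign b * (((P * S : QubitUnitary n) : QubitOp n) * (K * Kᴴ)).trace) := by
  rw [trace_mul_outcomeProjector_sandwich hS, ← mul_outcomeProjector_of_commute h,
    mul_assoc (P : QubitOp n), outcomeProjector_mul_self hS, trace_mul_outcomeProjector_mul]

/-- Elements of the group generated by pairwise commuting elements commute. -/
theorem mul_comm_of_mem_closure {G : Type*} [Group G] {s : Set G}
    (hs : ∀ x ∈ s, ∀ y ∈ s, x * y = y * x) {x y : G} (hx : x ∈ Subgroup.closure s)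
    (hy : y ∈ Subgroup.closure s) : x * y = y * x := by
  have h := Subgroup.isMulCommutative_closure hs
  exact congrArg Subtype.val (mul_comm' (⟨x, hx⟩ : Subgroup.closure s) ⟨y, hy⟩)

variable {V : Type*} [AddCommGroup V] [Module (ZMod 2) V]

/-- The stabilizer group generated by `𝒮` describes the operators `K o`, which are applied to the
input state when the outcomes are `o`: every generator fixes `K o` up to a sign that is linear in
`o`, every Pauli observable with non-zero expectation is in the group up to sign, and the
realizable outcomes form a linear subspace. -/
structure StabilizerInvariant (𝒮 : Set (QubitUnitary n)) (K : V → QubitOp n) : Prop where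
  observable : ∀ g ∈ 𝒮, IsPauliObservable g
  comm : ∀ g ∈ 𝒮, ∀ h ∈ 𝒮, g * h = h * g
  sign : ∀ g ∈ 𝒮, ∃ l : V →ₗ[ZMod 2] ZMod 2, ∀ o, (g : QubitOp n) * K o = bitSign (l o) • K o
  mem : ∀ o (P : QubitUnitary n), IsPauliObservable P →
    ((P : QubitOp n) * (K o * (K o)ᴴ)).trace ≠ 0 →
      P ∈ Subgroup.closure 𝒮 ∨ -P ∈ Subgroup.closure 𝒮
  linear : ∃ W : Submodule (ZMod 2) V, ∀ o, o ∈ W ↔ K o ≠ 0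

theorem stabilizerInvariant_empty :
    StabilizerInvariant (∅ : Set (QubitUnitary n)) (fun _ : V => (1 : QubitOp n)) where
  observable _ h := h.elim
  comm _ h := h.elim
  sign _ h := h.elim
  mem _ P hP h := by
    rw [conjTranspose_one, mul_one, mul_one] at h
    rcases hP.eq_one_or_neg_one h with rfl | rfl
    · exact Or.inl (one_mem _)
    · right; rw [neg_neg]; exact one_mem _
  linear := ⟨⊤, fun _ => by simp⟩

namespace StabilizerInvariant

variable {𝒮 : Set (QubitUnitary n)} {K : V → QubitOp n}

/-- Products of generators multiply the signs, hence add the functionals; an inverse keeps the sign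
because signs square to 1. -/
theorem sign_of_mem_closure (h : StabilizerInvariant 𝒮 K) {g : QubitUnitary n}
    (hg : g ∈ Subgroup.closure 𝒮) :
    ∃ l : V →ₗ[ZMod 2] ZMod 2, ∀ o, (g : QubitOp n) * K o = bitSign (l o) • K o := by
  induction hg using Subgroup.closure_induction with
  | mem g hg => exact h.sign g hg
  | one => exact ⟨0, fun o => by simp [bitSign_zero]⟩
  | mul a b _ _ iha ihb =>
    obtain ⟨l, hl⟩ := iha
    obtain ⟨m, hm⟩ := ihb
    refine ⟨l + m, fun o => ?_⟩
    rw [Submonoid.coe_mul, mul_assoc, hm, Matrix.mul_smul, hl, smul_smul, LinearMap.add_apply,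
      bitSign_add, mul_comm]
  | inv a _ ih =>
    obtain ⟨l, hl⟩ := ih
    refine ⟨l, fun o => ?_⟩
    have h1 : ((a⁻¹ : QubitUnitary n) : QubitOp n) * a = 1 :=
      congrArg Subtype.val (inv_mul_cancel a)
    calc ((a⁻¹ : QubitUnitary n) : QubitOp n) * K o
        = bitSign (l o) • (((a⁻¹ : QubitUnitary n) : QubitOp n) * (bitSign (l o) • K o)) := by
          rw [Matrix.mul_smul, smul_smul, bitSign_mul_self, one_smul]
      _ = bitSign (l o) • K o := by
          congr 1
          rw [← hl o, ← mul_assoc, h1, one_mul]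

theorem gate (h : StabilizerInvariant 𝒮 K) {U : QubitUnitary n} (hU : IsClifford U) :
    StabilizerInvariant ((fun T => U * T * U⁻¹) '' 𝒮) (fun o => (U : QubitOp n) * K o) where
  observable := by
    rintro _ ⟨g, hg, rfl⟩
    exact (h.observable g hg).conj (hU g (h.observable g hg).1)
  comm := by
    rintro _ ⟨a, ha, rfl⟩ _ ⟨b, hb, rfl⟩
    exact Commute.map (show Commute a b from h.comm a ha b hb) (MulAut.conj U)
  sign := by
    rintro _ ⟨g, hg, rfl⟩
    obtain ⟨l, hl⟩ := h.sign g hg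
    refine ⟨l, fun o => ?_⟩
    rw [← mul_assoc, ← Submonoid.coe_mul, inv_mul_cancel_right, Submonoid.coe_mul, mul_assoc, hl,
      Matrix.mul_smul]
  mem o P hP ht := by
    -- Heisenberg picture: the expectation of `P` after the gate is that of `U⁻¹ * P * U` before it.
    have hP' : IsPauliObservable (U⁻¹ * P * U) := by
      simpa using hP.conj (U := U⁻¹) (by simpa using hU.isPauli_conj_inv hP.1)
    have himage : ∀ Q : QubitUnitary n, U⁻¹ * Q * U ∈ Subgroup.closure 𝒮 →
        Q ∈ Subgroup.closure ((fun T => U * T * U⁻¹) '' 𝒮) := by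
      intro Q hQ
      have hmap := Subgroup.mem_map_of_mem (MulAut.conj U).toMonoidHom hQ
      rw [MonoidHom.map_closure] at hmap
      have hQ' : (MulAut.conj U).toMonoidHom (U⁻¹ * Q * U) = Q := by simp [mul_assoc]
      rwa [hQ'] at hmap
    have ht' : (((U⁻¹ * P * U : QubitUnitary n) : QubitOp n) * (K o * (K o)ᴴ)).trace ≠ 0 := by
      convert ht using 1
      rw [Submonoid.coe_mul, Submonoid.coe_mul, coe_inv_eq_conjTranspose, conjTranspose_mul]
      simp only [mul_assoc]
      rw [trace_mul_comm]
      simp only [mul_assoc]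
    rcases h.mem o _ hP' ht' with h1 | h1
    · exact Or.inl (himage P h1)
    · exact Or.inr (himage (-P) (by simpa using h1))
  linear := by
    obtain ⟨W, hW⟩ := h.linear
    refine ⟨W, fun o => (hW o).trans (not_congr ⟨fun h0 => by rw [h0, mul_zero], fun h0 => ?_⟩)⟩
    have h1 : ((U⁻¹ : QubitUnitary n) : QubitOp n) * U = 1 :=
      congrArg Subtype.val (inv_mul_cancel U)
    rw [← one_mul (K o), ← h1, mul_assoc, h0, mul_zero]

/-- Measuring an element of the stabilizer group yields a linear parity check. -/
theorem measure_of_mem (h : StabilizerInvariant 𝒮 K) {S : QubitUnitary n}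
    (hS : S ∈ Subgroup.closure 𝒮) (l : V →ₗ[ZMod 2] ZMod 2) :
    StabilizerInvariant 𝒮 (fun o => outcomeProjector S (l o) * K o) := by
  obtain ⟨m, hm⟩ := h.sign_of_mem_closure hS
  -- `S` acts on `K o` as `(-1) ^ m(o)`, so the projector keeps `K o` if `l o = m o` and kills it
  -- otherwise.
  have hK : ∀ o, outcomeProjector S (l o) * K o = if (l + m) o = 0 then K o else 0 := by
    intro o
    have h1 : outcomeProjector S (l o) * K o =
        (2⁻¹ * (1 + bitSign ((l + m) o))) • K o := by
      rw [outcomeProjector, Matrix.smul_mul, add_mul, one_mul, Matrix.smul_mul, hm, smul_smul,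
        ← bitSign_add, mul_smul, add_smul, one_smul, LinearMap.add_apply]
    rw [h1]
    rcases zmod_two_eq_zero_or_one ((l + m) o) with h0 | h0
    · rw [h0, bitSign_zero, if_pos rfl]; norm_num
    · rw [h0, bitSign_one, if_neg one_ne_zero]; norm_num
  simp only [hK]
  refine ⟨h.observable, h.comm, fun g hg => ?_, fun o P hP ht => ?_, ?_⟩
  · obtain ⟨k, hk⟩ := h.sign g hg
    refine ⟨k, fun o => ?_⟩
    split_ifs
    · exact hk o
    · simp
  · split_ifs at ht
    · exact h.mem o P hP ht
    · simp at ht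
  · obtain ⟨W, hW⟩ := h.linear
    refine ⟨W ⊓ LinearMap.ker (l + m), fun o => ?_⟩
    rw [Submodule.mem_inf, LinearMap.mem_ker, hW]
    split_ifs with h0
    · exact and_iff_left h0
    · exact ⟨fun h1 => absurd h1.2 h0, fun h1 => absurd rfl h1⟩

/-- Measuring a Pauli observable outside the stabilizer group gives a random outcome. Here `𝒯`
generates the part of the stabilizer group that commutes with the measured observable. -/
theorem measure_of_notMem (h : StabilizerInvariant 𝒮 K) {S : QubitUnitary n}
    (hS : IsPauliObservable S) (hpos : S ∉ Subgroup.closure 𝒮) (hneg : -S ∉ Subgroup.closure 𝒮)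
    {𝒯 : Set (QubitUnitary n)} (hobs : ∀ g ∈ 𝒯, IsPauliObservable g)
    (hsub : ∀ g ∈ 𝒯, g ∈ Subgroup.closure 𝒮) (hcomm : ∀ g ∈ 𝒯, g * S = S * g)
    (hgen : ∀ g ∈ Subgroup.closure 𝒮, g * S = S * g → g ∈ Subgroup.closure 𝒯)
    (l : V →ₗ[ZMod 2] ZMod 2) :
    StabilizerInvariant (insert S 𝒯) (fun o => outcomeProjector S (l o) * K o) where
  observable := by
    rintro g (rfl | hg)
    · exact hS
    · exact hobs g hg
  comm := by
    rintro a (rfl | ha) b (rfl | hb)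
    · rfl
    · exact (hcomm b hb).symm
    · exact hcomm a ha
    · exact mul_comm_of_mem_closure h.comm (hsub a ha) (hsub b hb)
  sign := by
    rintro g (rfl | hg)
    · exact ⟨l, fun o => by rw [← mul_assoc, mul_outcomeProjector_self hS, Matrix.smul_mul]⟩
    · obtain ⟨m, hm⟩ := h.sign_of_mem_closure (hsub g hg)
      refine ⟨m, fun o => ?_⟩
      rw [← mul_assoc, mul_outcomeProjector_of_commute (hcomm g hg), mul_assoc, hm,
        Matrix.mul_smul]
  mem o P hP ht := by
    have hmono : Subgroup.closure 𝒯 ≤ Subgroup.closure (insert S 𝒯) :=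
      Subgroup.closure_mono (Set.subset_insert S 𝒯)
    have hSmem : S ∈ Subgroup.closure (insert S 𝒯) :=
      Subgroup.subset_closure (Set.mem_insert S 𝒯)
    rcases hP.1.commute_or_anticommute hS.1 with hc | ha
    · have hcS : P * S * S = S * (P * S) := by rw [← mul_assoc, hc]
      have hsq : P * S * S = P := by rw [mul_assoc, hS.mul_self, mul_one]
      rw [trace_mul_outcomeProjector_sandwich_of_commute hS hc] at ht
      by_cases h1 : ((P : QubitOp n) * (K o * (K o)ᴴ)).trace = 0
      · have h2 : (((P * S : QubitUnitary n) : QubitOp n) * (K o * (K o)ᴴ)).trace ≠ 0 := by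
          intro h2
          rw [h1, h2, mul_zero, add_zero, mul_zero] at ht
          exact ht rfl
        rcases h.mem o _ (hP.mul hS hc) h2 with h3 | h3
        · left
          have h4 := mul_mem (hmono (hgen _ h3 hcS)) hSmem
          rwa [hsq] at h4
        · right
          have h4 := mul_mem (hmono (hgen _ h3 (by rw [neg_mul, mul_neg, hcS]))) hSmem
          rwa [neg_mul, hsq] at h4
      · exact (h.mem o P hP h1).imp (fun h3 => hmono (hgen _ h3 hc))
          (fun h3 => hmono (hgen _ h3 (by rw [neg_mul, mul_neg, hc])))
    · rw [trace_mul_outcomeProjector_sandwich hS, outcomeProjector_mul_mul_of_anticommute hS ha,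
        zero_mul, trace_zero] at ht
      exact absurd rfl ht
  linear := by
    obtain ⟨W, hW⟩ := h.linear
    refine ⟨W, fun o => (hW o).trans (not_congr ⟨fun h0 => by rw [h0, mul_zero], fun h0 => ?_⟩)⟩
    -- Since `S` has expectation zero, the squared norm of `K o` is exactly halved, so a non-zero `K
    -- o` stays non-zero.
    have ht := trace_mul_outcomeProjector_sandwich_of_commute hS (P := 1)
      (by rw [one_mul, mul_one]) (l o) (K o)
    have hS0 : ((S : QubitOp n) * (K o * (K o)ᴴ)).trace = 0 := by
      by_contra hne
      exact (h.mem o S hS hne).elim hpos hneg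
    rw [h0, one_mul, hS0, zero_mul, mul_zero, trace_zero, OneMemClass.coe_one, one_mul, mul_zero,
      add_zero, zero_eq_mul] at ht
    open scoped ComplexOrder in
    exact trace_mul_conjTranspose_self_eq_zero_iff.mp (ht.resolve_left (by norm_num))

/-- Removing a generator `T` and multiplying some of the other generators by `T` yields a group that
contains `g` or `T * g` for every element `g` of the stabilizer group. -/
theorem mem_closure_pivot (h : StabilizerInvariant 𝒮 K) {T : QubitUnitary n} (hT : T ∈ 𝒮)
    {f : QubitUnitary n → QubitUnitary n} (hf : ∀ g, f g = g ∨ f g = T * g)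
    {g : QubitUnitary n} (hg : g ∈ Subgroup.closure 𝒮) :
    g ∈ Subgroup.closure (f '' (𝒮 \ {T})) ∨ T * g ∈ Subgroup.closure (f '' (𝒮 \ {T})) := by
  -- As `T` is an involution commuting with the whole group, factors `T` can be collected and cancel
  -- in pairs.
  have hTT := (h.observable T hT).mul_self
  have hTmem := Subgroup.subset_closure (k := 𝒮) hT
  induction hg using Subgroup.closure_induction with
  | mem g hg =>
    by_cases hgT : g = T
    · right; rw [hgT, hTT]; exact one_mem _
    · have hmem : f g ∈ Subgroup.closure (f '' (𝒮 \ {T})) :=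
        Subgroup.subset_closure ⟨g, ⟨hg, hgT⟩, rfl⟩
      rcases hf g with h1 | h1 <;> rw [h1] at hmem
      · exact Or.inl hmem
      · exact Or.inr hmem
  | one => exact Or.inl (one_mem _)
  | mul a b ha hb iha ihb =>
    have hTa : T * a = a * T := mul_comm_of_mem_closure h.comm hTmem ha
    rcases iha with iha | iha <;> rcases ihb with ihb | ihb
    · exact Or.inl (mul_mem iha ihb)
    · right
      have := mul_mem iha ihb
      rwa [← mul_assoc, ← hTa, mul_assoc] at this
    · right
      have := mul_mem iha ihb
      rwa [mul_assoc] at this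
    · left
      have := mul_mem iha ihb
      rwa [hTa, mul_assoc, ← mul_assoc T, hTT, one_mul] at this
  | inv a ha ih =>
    have hTa : T * a = a * T := mul_comm_of_mem_closure h.comm hTmem ha
    refine ih.imp inv_mem fun h1 => ?_
    have := inv_mem h1
    rwa [hTa, _root_.mul_inv_rev, inv_eq_of_mul_eq_one_left hTT] at this

end StabilizerInvariant

end Stabilizer

end CliffordSim

/-! ### The invariant along the circuit, and realizability of outcomes. -/

namespace CliffordCircuit

open CliffordSim Matrix

variable {n : ℕ}

theorem stabilizerInvariant_updateGenerators {V : Type*} [AddCommGroup V] [Module (ZMod 2) V]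
    {𝒮 : Set (QubitUnitary n)} {K : V → QubitOp n} (h : StabilizerInvariant 𝒮 K)
    (rule : PivotRule n) (i : ℕ) (c : Operation n) (l : V →ₗ[ZMod 2] ZMod 2) :
    StabilizerInvariant (updateGenerators rule i 𝒮 c)
      (fun o => (flipSign 𝒮 c).kraus (l o) * K o) := by
  cases c with
  | gate U hU => exact h.gate hU
  | measure S hS =>
    by_cases hneg : -S ∈ Subgroup.closure 𝒮
    · rw [updateGenerators, if_pos (Or.inr hneg), flipSign, if_pos hneg]
      exact h.measure_of_mem hneg l
    by_cases hpos : S ∈ Subgroup.closure 𝒮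
    · rw [updateGenerators, if_pos (Or.inl hpos), flipSign, if_neg hneg]
      exact h.measure_of_mem hpos l
    rw [updateGenerators, if_neg (not_or.mpr ⟨hpos, hneg⟩), flipSign, if_neg hneg]
    split_ifs with hex
    · obtain ⟨hT, hTS⟩ := rule.pick_spec i 𝒮 S hex
      set T := rule.pick i 𝒮 S
      have hcomm : ∀ g ∈ (fun T' => if T' * S = -(S * T') then T * T' else T') '' (𝒮 \ {T}),
          g * S = S * g := by
        rintro _ ⟨g, ⟨hg, -⟩, rfl⟩
        dsimp only
        split_ifs with hgS
        -- Two factors that anticommute with `S` have a product that commutes with it.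
        · rw [mul_assoc, hgS, mul_neg, ← mul_assoc, hTS, neg_mul, neg_neg, mul_assoc]
        · exact ((h.observable g hg).1.commute_or_anticommute hS.1).resolve_right hgS
      refine h.measure_of_notMem hS hpos hneg ?_ ?_ hcomm (fun g hg hgS => ?_) l
      · rintro _ ⟨g, ⟨hg, -⟩, rfl⟩
        dsimp only
        split_ifs
        · exact (h.observable T hT).mul (h.observable g hg) (h.comm T hT g hg)
        · exact h.observable g hg
      · rintro _ ⟨g, ⟨hg, -⟩, rfl⟩
        dsimp only
        split_ifs
        · exact mul_mem (Subgroup.subset_closure hT) (Subgroup.subset_closure hg)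
        · exact Subgroup.subset_closure hg
      · refine (h.mem_closure_pivot hT (fun g => ?_) hg).resolve_right fun hTg => ?_
        · split_ifs
          · exact Or.inr rfl
          · exact Or.inl rfl
        -- The alternative `T * g` is impossible: it would commute with `S` as an element of the new
        -- group, yet it anticommutes with `S` because `T` does and `g` does not.
        · have hle : Subgroup.closure
              ((fun T' => if T' * S = -(S * T') then T * T' else T') '' (𝒮 \ {T})) ≤
              Subgroup.centralizer {S} :=
            (Subgroup.closure_le _).mpr fun x hx =>
              Subgroup.mem_centralizer_singleton_iff.mpr (hcomm x hx)
          have h1 := Subgroup.mem_centralizer_singleton_iff.mp (hle hTg)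
          have h2 : T * g * S = -(S * (T * g)) := by
            rw [mul_assoc, hgS, ← mul_assoc, hTS, neg_mul, mul_assoc]
          exact ne_neg_self _ (h1.symm.trans h2)
    · refine h.measure_of_notMem hS hpos hneg h.observable
        (fun g hg => Subgroup.subset_closure hg) (fun g hg => ?_) (fun g hg _ => hg) l
      exact ((h.observable g hg).1.commute_or_anticommute hS.1).resolve_right
        fun hgS => hex ⟨g, hg, hgS⟩

/-- The operator applied to the input state by the first `i` operations. -/
noncomputable def krausProduct (C : CliffordCircuit n) (o : C.Meas → ZMod 2) : ℕ → QubitOp n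
  | 0 => 1
  | i + 1 =>
    if h : i < C.size then (C.op ⟨i, h⟩).kraus (C.bit o ⟨i, h⟩) * C.krausProduct o i
    else C.krausProduct o i

theorem stateAfter_eq (C : CliffordCircuit n) (ρ : QubitOp n) (o : C.Meas → ZMod 2) (i : ℕ) :
    C.stateAfter ρ o i = C.krausProduct o i * ρ * (C.krausProduct o i)ᴴ := by
  induction i with
  | zero => simp [stateAfter, krausProduct]
  | succ i ih =>
    rw [stateAfter, krausProduct]
    split_ifs
    · rw [ih, conjTranspose_mul]
      simp only [mul_assoc]
    · exact ih

open scoped ComplexOrder in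
/-- An outcome is realizable if and only if the corresponding Kraus operator is non-zero; the
maximally mixed state witnesses this. -/
theorem mem_outcomeCode_iff (C : CliffordCircuit n) (o : C.Meas → ZMod 2) :
    o ∈ C.outcomeCode ↔ C.krausProduct o C.size ≠ 0 := by
  constructor
  · rintro ⟨ρ, -, hpos⟩ h0
    rw [outcomeProb, stateAfter_eq, h0, zero_mul, zero_mul, trace_zero] at hpos
    exact lt_irrefl _ hpos
  · intro hK
    have hcard : (0 : ℝ) < Fintype.card (Fin n → Fin 2) := by exact_mod_cast Fintype.card_pos
    -- The normalization `2⁻ⁿ` of the maximally mixed state.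
    set c : ℝ := (Fintype.card (Fin n → Fin 2) : ℝ)⁻¹ with hc
    have hcpos : 0 < c := inv_pos.mpr hcard
    refine ⟨(c : ℂ) • 1, ⟨PosSemidef.one.smul (by exact_mod_cast hcpos.le), ?_⟩, ?_⟩
    · rw [trace_smul, trace_one, smul_eq_mul, hc]
      push_cast
      exact inv_mul_cancel₀ (by exact_mod_cast hcard.ne')
    · have hpsd := posSemidef_self_mul_conjTranspose (C.krausProduct o C.size)
      have hne : (C.krausProduct o C.size * (C.krausProduct o C.size)ᴴ).trace ≠ 0 :=
        fun h0 => hK (trace_mul_conjTranspose_self_eq_zero_iff.mp h0)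
      have htr := lt_of_le_of_ne hpsd.trace_nonneg hne.symm
      rw [outcomeProb, stateAfter_eq, Matrix.mul_smul, mul_one, Matrix.smul_mul, trace_smul,
        smul_eq_mul, Complex.re_ofReal_mul]
      exact mul_pos hcpos (Complex.pos_iff.mp htr).1

/-- The outcome bit of an operation as a linear functional of the outcome bit-string. -/
theorem exists_bit_linear (C : CliffordCircuit n) (i : Fin C.size) :
    ∃ l : (C.Meas → ZMod 2) →ₗ[ZMod 2] ZMod 2, ∀ o, l o = C.bit o i := by
  by_cases h : (C.op i).IsMeasurement
  · exact ⟨LinearMap.proj ⟨i, h⟩, fun o => by simp [bit, h]⟩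
  · exact ⟨0, fun o => by simp [bit, h]⟩

/-- The generators come from the original circuit and the Kraus operators from the modified one.
This is consistent because a measurement whose sign is changed leaves the generators unchanged. All
outcome bits are variables from the start; bits not yet measured are unconstrained. -/
theorem stabilizerInvariant_generators (C : CliffordCircuit n) (rule : PivotRule n) (i : ℕ) :
    StabilizerInvariant (C.generators rule i) (fun o => (C.linearize rule).krausProduct o i) := by
  induction i with
  | zero => exact stabilizerInvariant_empty
  | succ i ih =>
    by_cases h : i < C.size
    · obtain ⟨l, hl⟩ := (C.linearize rule).exists_bit_linear ⟨i, h⟩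
      have h' : i < (C.linearize rule).size := h
      simp only [generators, krausProduct, dif_pos h, dif_pos h', ← hl]
      exact stabilizerInvariant_updateGenerators ih rule i (C.op ⟨i, h⟩) l
    · have h' : ¬ i < (C.linearize rule).size := h
      simpa only [generators, krausProduct, dif_neg h, dif_neg h'] using ih

end CliffordCircuit

theorem mainTheorem12 (n : ℕ) (C : CliffordCircuit n) (rule : CliffordCircuit.PivotRule n) :
    ∃ W : Submodule (ZMod 2) ((C.linearize rule).Meas → ZMod 2),
      (W : Set ((C.linearize rule).Meas → ZMod 2)) = (C.linearize rule).outcomeCode := by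
  obtain ⟨W, hW⟩ := (C.stabilizerInvariant_generators rule C.size).linear
  exact ⟨W, Set.ext fun o => (hW o).trans ((C.linearize rule).mem_outcomeCode_iff o).symm⟩
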